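/- All C*-algebras are complex and unital. For a C*-algebra $A$ let $S(A)\subset A^*$ denote its state space (the positive linear functionals $\varphi$ with $\varphi(1)=1$), with the weak-$*$ topology $\sigma(A^*,A)$. Let $A\otimes B$ denote the injective (spatial, minimal) C*-tensor product of two C*-algebras $A$ and $B$, that is, the norm closure of the algebraic tensor product in the bounded operators on the Hilbert space tensor product of the spaces of the universal representations of $A$ and $B$ (or of any faithful representations). For $\varphi\in S(A)$ and $\psi\in S(B)$ let $\varphi\otimes\psi\in S(A\otimes B)$ be the unique state with $(\varphi\otimes\psi)(a\otimes b)=\varphi(a)\psi(b)$ for all $a\in A$, $b\in B$. Let $S(A)\otimes S(B)=\{\varphi\otimes\psi : \varphi\in S(A),\ \psi\in S(B)\}$ be the set of product states; a state in its weak-$*$ closed convex hull in $(A\otimes B)^*$ is called separable. Let $A$ and $B$ be C*-algebras. Then the set $S(A)\otimes S(B)$ is weak-$*$ compact, and for every separable state $\omega$ on $A\otimes B$ there exists a regular Borel probability measure $\nu$ on $S(A)\otimes S(B)$ such that $$\omega=\int_{S(A)\otimes S(B)}\varphi\otimes\psi\; d\nu(\varphi\otimes\psi)$$ as a barycenter,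 i.e. $f(\omega)=\int f(\varphi\otimes\psi)\,d\nu(\varphi\otimes\psi)$ for every weak-$*$ continuous linear functional $f$ on $(A\otimes B)^*$. -/

import Mathlib

open scoped TensorProduct ComplexOrder InnerProductSpace ENNReal
open MeasureTheory UniformSpace

noncomputable section

namespace CStarSep

universe u v

/-! ### States -/

/-- The state space `S(A)` of a unital C*-algebra `A`: the positive normalized continuous linear
functionals, as a subset of the dual space `A*` with the weak-* topology. Positivity means
`0 ≤ φ (a* a)` for all `a`, the positive elements of a C*-algebra being the elements `a* a`. -/
def stateSpace (A : Type u) [CStarAlgebra A] : Set (WeakDual ℂ A) :=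
  {φ | (∀ a : A, 0 ≤ φ (star a * a)) ∧ φ 1 = 1}

/-! ### Direct sums of representations -/

section DirectSum

variable {ι : Type u} {H : ι → Type v} [∀ i, NormedAddCommGroup (H i)]
  [∀ i, InnerProductSpace ℂ (H i)]

lemma memlp_diag {T : ∀ i, H i →L[ℂ] H i} {C : ℝ} (hT : ∀ i, ‖T i‖ ≤ C) (x : lp H 2) :
    Memℓp (fun i => T i (x i)) 2 :=
  Memℓp.mono ((lp.memℓp x).norm.const_mul C) fun i =>
    ((T i).le_opNorm _).trans (mul_le_mul_of_nonneg_right (hT i) (norm_nonneg _))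

/-- The diagonal operator on a Hilbert space direct sum given by a bounded family of operators. -/
def diag (T : ∀ i, H i →L[ℂ] H i) (C : ℝ) (hT : ∀ i, ‖T i‖ ≤ C) : lp H 2 →L[ℂ] lp H 2 :=
  LinearMap.mkContinuous
    { toFun := fun x => ⟨fun i => T i (x i), memlp_diag hT x⟩
      map_add' := fun x y => by ext i; simp; rfl
      map_smul' := fun c x => by ext i; simp }
    |C| (fun x => by
      have h2 : 0 < (2 : ℝ≥0∞).toReal := by norm_num
      refine lp.norm_le_of_tsum_le h2 (by positivity) ?_
      rw [Real.mul_rpow (abs_nonneg C) (norm_nonneg x), lp.norm_rpow_eq_tsum h2, ← tsum_mul_left]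
      refine Summable.tsum_le_tsum (fun i => ?_)
        ((memlp_diag hT x).summable h2) (((lp.memℓp x).summable h2).mul_left _)
      rw [← Real.mul_rpow (abs_nonneg C) (norm_nonneg _)]
      refine Real.rpow_le_rpow (norm_nonneg _) ?_ h2.le
      exact ((T i).le_opNorm _).trans
        (mul_le_mul_of_nonneg_right ((hT i).trans (le_abs_self C)) (norm_nonneg _)))

@[simp] lemma diag_apply (T : ∀ i, H i →L[ℂ] H i) (C : ℝ) (hT : ∀ i, ‖T i‖ ≤ C) (x : lp H 2)
    (i : ι) : diag T C hT x i = T i (x i) := rfl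

variable [∀ i, CompleteSpace (H i)] {A : Type*} [CStarAlgebra A]

/-- The direct sum of a family of representations, on the Hilbert space direct sum. -/
def directSumRep (π : ∀ i, A →⋆ₐ[ℂ] (H i →L[ℂ] H i)) : A →⋆ₐ[ℂ] (lp H 2 →L[ℂ] lp H 2) where
  toFun a := diag (fun i => π i a) ‖a‖ fun i => NonUnitalStarAlgHom.norm_apply_le (π i) a
  map_one' := by ext x i; simp
  map_mul' a b := by ext x i; simp
  map_zero' := by ext x i; simp
  map_add' a b := by ext x i; simp
  commutes' c := by ext x i; simp [Algebra.algebraMap_eq_smul_one]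
  map_star' a := by
    rw [ContinuousLinearMap.star_eq_adjoint, ContinuousLinearMap.eq_adjoint_iff]
    intro x y
    rw [lp.inner_eq_tsum, lp.inner_eq_tsum]
    refine tsum_congr fun i => ?_
    rw [diag_apply, diag_apply, map_star, ContinuousLinearMap.star_eq_adjoint,
      ContinuousLinearMap.adjoint_inner_left]

@[simp] lemma directSumRep_apply (π : ∀ i, A →⋆ₐ[ℂ] (H i →L[ℂ] H i)) (a : A) (x : lp H 2)
    (i : ι) : directSumRep π a x i = π i a (x i) := rfl

end DirectSum

/-! ### The universal representation -/

section Universal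

/- The canonical order of a C*-algebra: `a ≤ b` iff `b - a` is selfadjoint with nonnegative
spectrum. -/
attribute [local instance 50] CStarAlgebra.spectralOrder CStarAlgebra.spectralOrderedRing

variable {A : Type u} [CStarAlgebra A]

/-- A state, as a positive linear map for the canonical order of `A`. -/
def toPositive (φ : stateSpace A) : A →ₚ[ℂ] ℂ :=
  PositiveLinearMap.mk₀ (φ.1 : A →ₗ[ℂ] ℂ) (by
    intro x hx
    obtain ⟨y, rfl⟩ := CStarAlgebra.nonneg_iff_eq_star_mul_self.mp hx
    exact φ.2.1 y)

/-- The Gelfand-Naimark-Segal Hilbert space of a state. -/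
abbrev GNSSpace (φ : stateSpace A) : Type u := (toPositive φ).GNS

/-- The Gelfand-Naimark-Segal representation of a state. -/
def gnsRep (φ : stateSpace A) : A →⋆ₐ[ℂ] (GNSSpace φ →L[ℂ] GNSSpace φ) :=
  (toPositive φ).gnsStarAlgHom

/-- The Hilbert space of the universal representation: the Hilbert space direct sum of the
Gelfand-Naimark-Segal spaces of all the states. -/
abbrev UnivSpace (A : Type u) [CStarAlgebra A] : Type u :=
  lp (fun φ : stateSpace A => GNSSpace φ) 2

/-- The universal representation of `A`. -/
def univRep (A : Type u) [CStarAlgebra A] : A →⋆ₐ[ℂ] (UnivSpace A →L[ℂ] UnivSpace A) :=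
  directSumRep gnsRep

/-- The cyclic vector of the Gelfand-Naimark-Segal representation. -/
def cyc (φ : stateSpace A) : GNSSpace φ :=
  (((toPositive φ).toPreGNS 1 : (toPositive φ).PreGNS) : Completion _)

lemma cyc_inner (φ : stateSpace A) (a : A) : ⟪cyc φ, gnsRep φ a (cyc φ)⟫_ℂ = φ.1 a := by
  change ⟪(((toPositive φ).toPreGNS 1 : (toPositive φ).PreGNS) : Completion _),
    (toPositive φ).gnsNonUnitalStarAlgHom a
      (((toPositive φ).toPreGNS 1 : (toPositive φ).PreGNS) : Completion _)⟫_ℂ = _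
  rw [PositiveLinearMap.gnsNonUnitalStarAlgHom_apply_coe, Completion.inner_coe,
    PositiveLinearMap.preGNS_inner_def]
  simp
  rfl

open Classical in
/-- The cyclic vector of a state, in the space of the universal representation. -/
def univCyc (φ : stateSpace A) : UnivSpace A := lp.single 2 φ (cyc φ)

lemma univCyc_inner (φ : stateSpace A) (a : A) :
    ⟪univCyc φ, univRep A a (univCyc φ)⟫_ℂ = φ.1 a := by
  classical
  rw [univCyc, lp.inner_single_left, univRep, directSumRep_apply, lp.single_apply_self, cyc_inner]

end Universal

/-! ### The injective tensor product -/

section Spatial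

variable {A : Type u} {B : Type v} [CStarAlgebra A] [CStarAlgebra B]
variable {H K : Type*} [NormedAddCommGroup H] [InnerProductSpace ℂ H]
  [NormedAddCommGroup K] [InnerProductSpace ℂ K]

/-- The Hilbert space tensor product: the completion of the algebraic tensor product for the inner
product `⟪x ⊗ y, x' ⊗ y'⟫ = ⟪x, x'⟫ * ⟪y, y'⟫`. -/
def HilbertTensor (H K : Type*) [NormedAddCommGroup H] [InnerProductSpace ℂ H]
    [NormedAddCommGroup K] [InnerProductSpace ℂ K] : Type _ := Completion (H ⊗[ℂ] K)

instance : NormedAddCommGroup (HilbertTensor H K) :=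
  inferInstanceAs (NormedAddCommGroup (Completion (H ⊗[ℂ] K)))

instance : InnerProductSpace ℂ (HilbertTensor H K) :=
  inferInstanceAs (InnerProductSpace ℂ (Completion (H ⊗[ℂ] K)))

instance : CompleteSpace (HilbertTensor H K) :=
  inferInstanceAs (CompleteSpace (Completion (H ⊗[ℂ] K)))

/-- The bounded operators on the Hilbert space tensor product. -/
abbrev TensorOp (H K : Type*) [NormedAddCommGroup H] [InnerProductSpace ℂ H]
    [NormedAddCommGroup K] [InnerProductSpace ℂ K] : Type _ :=
  HilbertTensor H K →L[ℂ] HilbertTensor H K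

/-- The inclusion of the algebraic tensor product in the Hilbert space tensor product. -/
def incl : (H ⊗[ℂ] K) →ₗᵢ[ℂ] HilbertTensor H K :=
  (Completion.toComplₗᵢ : (H ⊗[ℂ] K) →ₗᵢ[ℂ] Completion (H ⊗[ℂ] K))

lemma denseRange_incl : DenseRange (incl : (H ⊗[ℂ] K) →ₗᵢ[ℂ] HilbertTensor H K) :=
  Completion.denseRange_coe

/-- The operator `S ⊗ T` on the Hilbert space tensor product. -/
def opTensor (S : H →L[ℂ] H) (T : K →L[ℂ] K) : TensorOp H K :=
  (TensorProduct.mapL S T).completion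

lemma opTensor_incl (S : H →L[ℂ] H) (T : K →L[ℂ] K) (x : H ⊗[ℂ] K) :
    opTensor S T (incl x) = incl (TensorProduct.mapL S T x) :=
  ContinuousLinearMap.completion_apply_coe _ _

lemma op_ext {S T : TensorOp H K}
    (h : ∀ (x : H) (y : K), S (incl (x ⊗ₜ[ℂ] y)) = T (incl (x ⊗ₜ[ℂ] y))) : S = T := by
  ext z
  induction z using denseRange_incl.induction_on with
  | hp => exact isClosed_eq S.continuous T.continuous
  | ih z =>
    induction z using TensorProduct.induction_on with
    | zero => rw [map_zero, map_zero, map_zero]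
    | tmul x y => exact h x y
    | add z w hz hw => rw [map_add, map_add, map_add, hz, hw]

lemma opTensor_tmul (S : H →L[ℂ] H) (T : K →L[ℂ] K) (x : H) (y : K) :
    opTensor S T (incl (x ⊗ₜ[ℂ] y)) = incl (S x ⊗ₜ[ℂ] T y) := by
  rw [opTensor_incl, TensorProduct.mapL_tmul]

lemma opTensor_mul (S S' : H →L[ℂ] H) (T T' : K →L[ℂ] K) :
    opTensor (S * S') (T * T') = opTensor S T * opTensor S' T' :=
  op_ext fun x y => by simp [opTensor_tmul]

lemma opTensor_one : opTensor (1 : H →L[ℂ] H) (1 : K →L[ℂ] K) = 1 :=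
  op_ext fun x y => by simp [opTensor_tmul]

/-- The bilinear map `(S, T) ↦ S ⊗ T`. -/
def opTensorBilin : (H →L[ℂ] H) →ₗ[ℂ] (K →L[ℂ] K) →ₗ[ℂ]
    TensorOp H K :=
  LinearMap.mk₂ ℂ opTensor
    (fun S S' T => op_ext fun x y => by
      simp [opTensor_tmul, TensorProduct.add_tmul])
    (fun c S T => op_ext fun x y => by
      rw [smul_apply, opTensor_tmul, opTensor_tmul,
        smul_apply, ← TensorProduct.smul_tmul', map_smul])
    (fun S T T' => op_ext fun x y => by
      simp [opTensor_tmul, TensorProduct.tmul_add])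
    (fun c S T => op_ext fun x y => by
      rw [smul_apply, opTensor_tmul, opTensor_tmul,
        smul_apply, TensorProduct.tmul_smul, map_smul])

@[simp] lemma opTensorBilin_apply (S : H →L[ℂ] H) (T : K →L[ℂ] K) :
    opTensorBilin S T = opTensor S T := rfl

variable [CompleteSpace H] [CompleteSpace K]

lemma opTensor_star (S : H →L[ℂ] H) (T : K →L[ℂ] K) :
    opTensor (star S) (star T) = star (opTensor S T) := by
  rw [ContinuousLinearMap.star_eq_adjoint (opTensor S T), ContinuousLinearMap.eq_adjoint_iff]
  intro z w
  induction z, w using denseRange_incl.induction_on₂ with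
  | hp => apply isClosed_eq <;> fun_prop
  | h z w =>
    rw [opTensor_incl, opTensor_incl, LinearIsometry.inner_map_map, LinearIsometry.inner_map_map]
    induction z using TensorProduct.induction_on with
    | zero => simp
    | add z z' h h' => rw [map_add, inner_add_left, inner_add_left, h, h']
    | tmul x y =>
      induction w using TensorProduct.induction_on with
      | zero => simp
      | add z z' h h' => rw [map_add, inner_add_right, inner_add_right, h, h']
      | tmul x' y' =>
        simp [-TensorProduct.mapL_apply, TensorProduct.mapL_tmul,
          ContinuousLinearMap.star_eq_adjoint, ContinuousLinearMap.adjoint_inner_left]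

/-- The algebra homomorphism `a ⊗ b ↦ π a ⊗ ρ b` on the algebraic tensor product. -/
def tensorRepAlg (π : A →⋆ₐ[ℂ] (H →L[ℂ] H)) (ρ : B →⋆ₐ[ℂ] (K →L[ℂ] K)) :
    A ⊗[ℂ] B →ₐ[ℂ] TensorOp H K :=
  Algebra.TensorProduct.algHomOfLinearMapTensorProduct
    (TensorProduct.lift (opTensorBilin.compl₁₂ π.toAlgHom.toLinearMap ρ.toAlgHom.toLinearMap))
    (fun a a' b b' => by
      change opTensor (π (a * a')) (ρ (b * b')) = opTensor (π a) (ρ b) * opTensor (π a') (ρ b')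
      rw [map_mul, map_mul, opTensor_mul])
    (by
      change opTensor (π 1) (ρ 1) = 1
      rw [map_one, map_one, opTensor_one])

lemma tensorRepAlg_tmul (π : A →⋆ₐ[ℂ] (H →L[ℂ] H)) (ρ : B →⋆ₐ[ℂ] (K →L[ℂ] K))
    (a : A) (b : B) : tensorRepAlg π ρ (a ⊗ₜ[ℂ] b) = opTensor (π a) (ρ b) := rfl

/-- The representation `π ⊗ ρ` of the algebraic tensor product on the Hilbert space tensor
product, `(π ⊗ ρ) (a ⊗ b) = π a ⊗ ρ b`. -/
def tensorRep (π : A →⋆ₐ[ℂ] (H →L[ℂ] H)) (ρ : B →⋆ₐ[ℂ] (K →L[ℂ] K)) :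
    A ⊗[ℂ] B →⋆ₐ[ℂ] TensorOp H K :=
  { tensorRepAlg π ρ with
    map_star' := fun z => by
      change tensorRepAlg π ρ (star z) = star (tensorRepAlg π ρ z)
      induction z using TensorProduct.induction_on with
      | zero => rw [star_zero, map_zero]; exact (star_zero _).symm
      | tmul a b =>
        rw [TensorProduct.star_tmul, tensorRepAlg_tmul, tensorRepAlg_tmul, map_star, map_star,
          opTensor_star]
      | add z w hz hw => rw [star_add, map_add, map_add, hz, hw]; exact (star_add _ _).symm }

@[simp] lemma tensorRep_tmul (π : A →⋆ₐ[ℂ] (H →L[ℂ] H)) (ρ : B →⋆ₐ[ℂ] (K →L[ℂ] K))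
    (a : A) (b : B) : tensorRep π ρ (a ⊗ₜ[ℂ] b) = opTensor (π a) (ρ b) := rfl

end Spatial

variable (A : Type u) (B : Type v) [CStarAlgebra A] [CStarAlgebra B]

/-- The injective (spatial) C*-tensor product of `A` and `B`: the norm closure of the algebraic
tensor product `A ⊗ B` in the bounded operators on the Hilbert space tensor product of the
universal representations of `A` and `B`, which are faithful. -/
def injSubalgebra : StarSubalgebra ℂ (TensorOp (UnivSpace A) (UnivSpace B)) :=
  (tensorRep (univRep A) (univRep B)).range.topologicalClosure

instance : IsClosed (injSubalgebra A B : Set (TensorOp (UnivSpace A) (UnivSpace B))) :=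
  StarSubalgebra.isClosed_topologicalClosure _

/-- The injective C*-tensor product, as a C*-algebra. -/
def InjTensor : Type (max u v) := injSubalgebra A B

instance : CStarAlgebra (InjTensor A B) :=
  inferInstanceAs (CStarAlgebra (injSubalgebra A B))

/-- The inclusion of the injective tensor product in the bounded operators. -/
def InjTensor.toOp : InjTensor A B →⋆ₐ[ℂ] TensorOp (UnivSpace A) (UnivSpace B) :=
  (injSubalgebra A B).subtype

/-- The canonical map from the algebraic to the injective tensor product. -/
def InjTensor.ofAlg : A ⊗[ℂ] B →⋆ₐ[ℂ] InjTensor A B :=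
  (tensorRep (univRep A) (univRep B)).codRestrict (injSubalgebra A B)
    fun z => StarSubalgebra.le_topologicalClosure _ ⟨z, rfl⟩

variable {A B}

lemma InjTensor.continuous_toOp : Continuous (InjTensor.toOp A B) := continuous_subtype_val

lemma InjTensor.denseRange_ofAlg : DenseRange (InjTensor.ofAlg A B) := by
  intro x
  change (x : injSubalgebra A B) ∈ closure (X := injSubalgebra A B) _
  refine closure_subtype.mpr ?_
  refine closure_mono ?_ x.2
  rintro _ ⟨z, rfl⟩
  exact ⟨InjTensor.ofAlg A B z, ⟨z, rfl⟩, rfl⟩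

/-- The elementary tensor `a ⊗ b` in the injective C*-tensor product. -/
def InjTensor.tmul (a : A) (b : B) : InjTensor A B := InjTensor.ofAlg A B (a ⊗ₜ[ℂ] b)

/-! ### Product states and separable states -/

/-- `ω` is the product state `φ ⊗ ψ`: the state on the injective tensor product with
`(φ ⊗ ψ) (a ⊗ b) = φ a * ψ b`. -/
def IsProduct (ω : WeakDual ℂ (InjTensor A B)) (φ : WeakDual ℂ A) (ψ : WeakDual ℂ B) : Prop :=
  ω ∈ stateSpace (InjTensor A B) ∧ ∀ (a : A) (b : B), ω (InjTensor.tmul a b) = φ a * ψ b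

lemma exists_isProduct (φ : stateSpace A) (ψ : stateSpace B) :
    ∃ ω : WeakDual ℂ (InjTensor A B), IsProduct ω φ.1 ψ.1 := by
  let ξ : HilbertTensor (UnivSpace A) (UnivSpace B) := incl (univCyc φ ⊗ₜ[ℂ] univCyc ψ)
  let L : InjTensor A B →L[ℂ] ℂ :=
    ⟨(innerSL ℂ ξ).toLinearMap ∘ₗ (ContinuousLinearMap.apply ℂ _ ξ).toLinearMap ∘ₗ
      (InjTensor.toOp A B).toAlgHom.toLinearMap,
      ((innerSL ℂ ξ).continuous.comp (ContinuousLinearMap.apply ℂ _ ξ).continuous).comp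
        InjTensor.continuous_toOp⟩
  have hL (x : InjTensor A B) : L x = ⟪ξ, InjTensor.toOp A B x ξ⟫_ℂ := rfl
  have key (a : A) (b : B) : L (InjTensor.tmul a b) = φ.1 a * ψ.1 b := by
    rw [hL]
    change ⟪incl (univCyc φ ⊗ₜ[ℂ] univCyc ψ),
      opTensor (univRep A a) (univRep B b) (incl _)⟫_ℂ = _
    rw [opTensor_tmul, LinearIsometry.inner_map_map, TensorProduct.inner_tmul, univCyc_inner,
      univCyc_inner]
  have h1 : (1 : InjTensor A B) = InjTensor.tmul 1 1 :=
    (map_one (InjTensor.ofAlg A B)).symm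
  refine ⟨StrongDual.toWeakDual L, ⟨fun x => ?_, ?_⟩, key⟩
  · change 0 ≤ L (star x * x)
    rw [hL, map_mul, map_star]
    change 0 ≤ ⟪ξ, (star (InjTensor.toOp A B x)) (InjTensor.toOp A B x ξ)⟫_ℂ
    rw [ContinuousLinearMap.star_eq_adjoint, ContinuousLinearMap.adjoint_inner_right,
      inner_self_eq_norm_sq_to_K, ← RCLike.ofReal_pow]
    exact Complex.zero_le_real.mpr (sq_nonneg _)
  · change L 1 = 1
    rw [h1, key, φ.2.2, ψ.2.2, one_mul]

/-- For states `φ` and `ψ` there is exactly one product state `φ ⊗ ψ`. -/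
theorem existsUnique_isProduct (φ : stateSpace A) (ψ : stateSpace B) :
    ∃! ω : WeakDual ℂ (InjTensor A B), IsProduct ω φ.1 ψ.1 := by
  obtain ⟨ω, hω⟩ := exists_isProduct φ ψ
  refine ⟨ω, hω, fun ω' hω' => ?_⟩
  have h (z : A ⊗[ℂ] B) : ω' (InjTensor.ofAlg A B z) = ω (InjTensor.ofAlg A B z) := by
    induction z using TensorProduct.induction_on with
    | zero => rw [map_zero, map_zero, map_zero]
    | tmul a b => exact (hω'.2 a b).trans (hω.2 a b).symm
    | add z w hz hw => rw [map_add, map_add, map_add, hz, hw]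
  exact DFunLike.coe_injective
    (InjTensor.denseRange_ofAlg.equalizer (map_continuous ω') (map_continuous ω) (funext h))

variable (A B)

/-- The set `S(A) ⊗ S(B)` of product states. -/
def productStates : Set (WeakDual ℂ (InjTensor A B)) :=
  {ω | ∃ φ ∈ stateSpace A, ∃ ψ ∈ stateSpace B, IsProduct ω φ ψ}

/-- The set of separable states: the weak-* closed convex hull of the product states. -/
def separableStates : Set (WeakDual ℂ (InjTensor A B)) :=
  closedConvexHull ℝ (productStates A B)

variable {A B}

/-! ### Barycenters -/

/-- The measure `μ` on a subset `K` of a complex topological vector space represents the point `x`,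
that is, `x` is its barycenter `∫_K y dμ(y)`: `f x = ∫_K f dμ` for every continuous linear
functional `f`. -/
def Represents {E : Type*} [AddCommGroup E] [Module ℂ E] [TopologicalSpace E] {K : Set E}
    [MeasurableSpace K] (μ : Measure K) (x : E) : Prop :=
  ∀ f : E →L[ℂ] ℂ, Integrable (fun y : K => f y) μ ∧ f x = ∫ y : K, f y ∂μ

/-- The Borel sets of the set of product states, for the weak-* topology. -/
instance : MeasurableSpace (productStates A B) := borel (productStates A B)

instance : BorelSpace (productStates A B) := ⟨rfl⟩

end CStarSep

end

/-! The probability measures on a compact Hausdorff space `K` form a weakly compact space, and the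
pairs `(μ, x)` for which `x` is the barycenter of `μ` form a closed set. Its projection to the
second coordinate is therefore closed. It is also convex and, by the point masses, contains `K`,
hence its closed convex hull; Riesz-Markov-Kakutani replaces the measure by a regular one. That the
product states are compact follows from the same projection argument, applied to the triples
`(ω, φ, ψ)` with `ω = φ ⊗ ψ` in the compact set `S(A ⊗ B) × S(A) × S(B)`. -/

open scoped NNReal

namespace CStarSep

section Integral

variable {X : Type*} [TopologicalSpace X] [CompactSpace X] [MeasurableSpace X]
  {𝕜 : Type*} [RCLike 𝕜]

lemma integrable_continuousMap [OpensMeasurableSpace X] (μ : Measure X) [IsFiniteMeasure μ]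
    (g : C(X, 𝕜)) : Integrable g μ :=
  (BoundedContinuousFunction.mkOfCompact g).integrable μ

lemma continuous_integral_continuousMap [OpensMeasurableSpace X] (g : C(X, 𝕜)) :
    Continuous fun μ : ProbabilityMeasure X => ∫ y, g y ∂(μ : Measure X) :=
  continuous_iff_continuousAt.mpr fun _ =>
    (ProbabilityMeasure.tendsto_iff_forall_integral_rclike_tendsto 𝕜).mp Filter.tendsto_id
      (BoundedContinuousFunction.mkOfCompact g)

variable [T2Space X] [BorelSpace X]

lemma exists_regular_forall_integral_eq (𝕜 : Type*) [RCLike 𝕜] (μ : Measure X)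
    [IsFiniteMeasure μ] :
    ∃ ν : Measure X, ν.Regular ∧ IsFiniteMeasure ν ∧
      ∀ g : C(X, 𝕜), ∫ y, g y ∂μ = ∫ y, g y ∂ν := by
  obtain ⟨ν, hregular, hfinite, hν⟩ := Measure.exists_regular_eq_of_compactSpace μ
  refine ⟨ν, hregular, hfinite, fun g => ?_⟩
  have hre : ∫ y, RCLike.re (g y) ∂μ = ∫ y, RCLike.re (g y) ∂ν :=
    hν (BoundedContinuousFunction.mkOfCompact ⟨fun y => RCLike.re (g y), by fun_prop⟩)
  have him : ∫ y, RCLike.im (g y) ∂μ = ∫ y, RCLike.im (g y) ∂ν :=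
    hν (BoundedContinuousFunction.mkOfCompact ⟨fun y => RCLike.im (g y), by fun_prop⟩)
  rw [← integral_re_add_im (integrable_continuousMap μ g),
    ← integral_re_add_im (integrable_continuousMap ν g), hre, him]

lemma exists_regular_isProbabilityMeasure_forall_integral_eq (𝕜 : Type*) [RCLike 𝕜]
    (μ : Measure X) [IsProbabilityMeasure μ] :
    ∃ ν : Measure X, IsProbabilityMeasure ν ∧ ν.Regular ∧
      ∀ g : C(X, 𝕜), ∫ y, g y ∂μ = ∫ y, g y ∂ν := by
  obtain ⟨ν, hregular, _, hν⟩ := exists_regular_forall_integral_eq 𝕜 μ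
  have hmass : (1 : 𝕜) = (ν.real Set.univ : 𝕜) := by
    simpa [RCLike.real_smul_eq_coe_mul] using hν 1
  exact ⟨ν, isProbabilityMeasure_iff_real.mpr (by exact_mod_cast hmass.symm), hregular, hν⟩

end Integral

section Barycenter

variable {E : Type*} [AddCommGroup E] [Module ℂ E] [TopologicalSpace E] {K : Set E}
  [MeasurableSpace K] {x y : E}

lemma Represents.add {μ ν : Measure K} (hμ : Represents μ x) (hν : Represents ν y) :
    Represents (μ + ν) (x + y) := fun f => by
  obtain ⟨hμi, hμf⟩ := hμ f
  obtain ⟨hνi, hνf⟩ := hν f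
  exact ⟨hμi.add_measure hνi, by rw [map_add, hμf, hνf, integral_add_measure hμi hνi]⟩

lemma Represents.smul [Module ℝ E] [IsScalarTower ℝ ℂ E] {μ : Measure K} (c : ℝ≥0)
    (h : Represents μ x) : Represents (c • μ) ((c : ℝ) • x) := fun f => by
  obtain ⟨hi, hf⟩ := h f
  refine ⟨hi.smul_measure_nnreal, ?_⟩
  rw [f.map_smul_of_tower, hf, integral_smul_nnreal_measure, NNReal.smul_def]

lemma represents_dirac [OpensMeasurableSpace K] (x : K) :
    Represents (Measure.dirac x) (x : E) := fun f => by
  have hf : StronglyMeasurable fun y : K => f y :=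
    (show Continuous fun y : K => f y by fun_prop).measurable.stronglyMeasurable
  exact ⟨integrable_dirac' hf (by simp), (integral_dirac' _ _ hf).symm⟩

lemma represents_iff_forall_eq_integral [CompactSpace K] [OpensMeasurableSpace K]
    {μ : Measure K} [IsFiniteMeasure μ] :
    Represents μ x ↔ ∀ f : E →L[ℂ] ℂ, f x = ∫ y : K, f y ∂μ :=
  forall_congr' fun f =>
    and_iff_right (integrable_continuousMap μ ((f : C(E, ℂ)).restrict K))

lemma isClosed_setOf_represents [CompactSpace K] [OpensMeasurableSpace K] :
    IsClosed {p : ProbabilityMeasure K × E | Represents (p.1 : Measure K) p.2} := by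
  simp only [represents_iff_forall_eq_integral, Set.ofPred_forall]
  exact isClosed_iInter fun f => isClosed_eq (by fun_prop)
    ((continuous_integral_continuousMap ((f : C(E, ℂ)).restrict K)).comp continuous_fst)

/-- The set of barycenters of the Borel probability measures on `K`. The measures need not be
regular: this makes it a projection from the space of all Borel probability measures, which is
compact when `K` is. -/
def barycenters (K : Set E) [MeasurableSpace K] : Set E :=
  {x | ∃ μ : ProbabilityMeasure K, Represents (μ : Measure K) x}

lemma subset_barycenters [OpensMeasurableSpace K] : K ⊆ barycenters K :=
  fun x hx => ⟨⟨Measure.dirac ⟨x, hx⟩, inferInstance⟩, represents_dirac ⟨x, hx⟩⟩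

lemma convex_barycenters [Module ℝ E] [IsScalarTower ℝ ℂ E] : Convex ℝ (barycenters K) := by
  rintro x ⟨μ, hμ⟩ y ⟨ν, hν⟩ a b ha hb hab
  lift a to ℝ≥0 using ha
  lift b to ℝ≥0 using hb
  have hmass : IsProbabilityMeasure (a • (μ : Measure K) + b • (ν : Measure K)) :=
    ⟨by
      simp only [Measure.coe_add, Measure.coe_nnreal_smul_apply, Pi.add_apply, measure_univ,
        mul_one]
      exact_mod_cast hab⟩
  exact ⟨⟨_, hmass⟩, (hμ.smul a).add (hν.smul b)⟩

lemma isClosed_barycenters [CompactSpace K] [T2Space K] [BorelSpace K] :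
    IsClosed (barycenters K) := by
  convert isClosedMap_snd_of_compactSpace _ (isClosed_setOf_represents (K := K)) using 1
  ext x
  simp [barycenters]

lemma exists_regular_represents_of_mem_barycenters [CompactSpace K] [T2Space K] [BorelSpace K]
    (hx : x ∈ barycenters K) :
    ∃ ν : Measure K, IsProbabilityMeasure ν ∧ ν.Regular ∧ Represents ν x := by
  obtain ⟨μ, hμ⟩ := hx
  obtain ⟨ν, hprob, hregular, hν⟩ :=
    exists_regular_isProbabilityMeasure_forall_integral_eq ℂ (μ : Measure K)
  refine ⟨ν, hprob, hregular, represents_iff_forall_eq_integral.mpr fun f => ?_⟩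
  exact (hμ f).2.trans (hν ((f : C(E, ℂ)).restrict K))

theorem exists_regular_represents_of_mem_closedConvexHull [BorelSpace K] [Module ℝ E]
    [IsScalarTower ℝ ℂ E] [T2Space E] (hK : IsCompact K) (hx : x ∈ closedConvexHull ℝ K) :
    ∃ ν : Measure K, IsProbabilityMeasure ν ∧ ν.Regular ∧ Represents ν x := by
  have : CompactSpace K := isCompact_iff_compactSpace.mp hK
  exact exists_regular_represents_of_mem_barycenters
    (closedConvexHull_min subset_barycenters convex_barycenters isClosed_barycenters hx)

end Barycenter

section States

instance {F : Type*} [AddCommGroup F] [Module ℂ F] [TopologicalSpace F] :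
    IsScalarTower ℝ ℂ (WeakDual ℂ F) :=
  inferInstanceAs (IsScalarTower ℝ ℂ (F →L[ℂ] ℂ))

variable {A B : Type*} [CStarAlgebra A] [CStarAlgebra B]

lemma norm_cyc (φ : stateSpace A) : ‖cyc φ‖ = 1 := by
  have hinner : ⟪cyc φ, cyc φ⟫_ℂ = 1 := by simpa [φ.2.2] using cyc_inner φ 1
  rw [norm_eq_sqrt_re_inner (𝕜 := ℂ), hinner, RCLike.one_re, Real.sqrt_one]

lemma norm_apply_le_of_mem_stateSpace {φ : WeakDual ℂ A} (hφ : φ ∈ stateSpace A) (a : A) :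
    ‖φ a‖ ≤ ‖a‖ := by
  let ξ := cyc ⟨φ, hφ⟩
  let π := gnsRep ⟨φ, hφ⟩
  calc ‖φ a‖ = ‖⟪ξ, π a ξ⟫_ℂ‖ := by rw [cyc_inner]
    _ ≤ ‖ξ‖ * ‖π a ξ‖ := norm_inner_le_norm _ _
    _ ≤ ‖ξ‖ * (‖π a‖ * ‖ξ‖) := by gcongr; exact (π a).le_opNorm ξ
    _ = ‖π a‖ := by rw [norm_cyc, one_mul, mul_one]
    _ ≤ ‖a‖ := NonUnitalStarAlgHom.norm_apply_le π a

lemma stateSpace_subset_closedBall :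
    stateSpace A ⊆ WeakDual.toStrongDual ⁻¹' Metric.closedBall 0 1 := fun _ hφ =>
  mem_closedBall_zero_iff.mpr <| ContinuousLinearMap.opNorm_le_bound _ zero_le_one fun a =>
    (norm_apply_le_of_mem_stateSpace hφ a).trans_eq (one_mul _).symm

lemma isClosed_stateSpace : IsClosed (stateSpace A) := by
  simp only [stateSpace, Set.ofPred_and, Set.ofPred_forall]
  exact (isClosed_iInter fun a => isClosed_le continuous_const (WeakDual.eval_continuous _)).inter
    (isClosed_eq (WeakDual.eval_continuous _) continuous_const)

theorem isCompact_stateSpace : IsCompact (stateSpace A) :=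
  (WeakDual.isCompact_closedBall 0 1).of_isClosed_subset isClosed_stateSpace
    stateSpace_subset_closedBall

lemma isClosed_setOf_forall_apply_tmul_eq_mul :
    IsClosed {p : WeakDual ℂ (InjTensor A B) × WeakDual ℂ A × WeakDual ℂ B |
      ∀ a b, p.1 (InjTensor.tmul a b) = p.2.1 a * p.2.2 b} := by
  simp only [Set.ofPred_forall]
  refine isClosed_iInter fun a => isClosed_iInter fun b => isClosed_eq ?_ (.mul ?_ ?_)
  · exact (WeakDual.eval_continuous _).comp continuous_fst
  · exact (WeakDual.eval_continuous a).comp (continuous_fst.comp continuous_snd)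
  · exact (WeakDual.eval_continuous b).comp (continuous_snd.comp continuous_snd)

theorem isCompact_productStates : IsCompact (productStates A B) := by
  convert ((isCompact_stateSpace.prod (isCompact_stateSpace.prod isCompact_stateSpace)).inter_right
    (isClosed_setOf_forall_apply_tmul_eq_mul (A := A) (B := B))).image continuous_fst using 1
  ext ω
  simp only [productStates, IsProduct, Set.mem_image, Set.mem_inter_iff, Set.mem_prod,
    Prod.exists, Set.mem_ofPred_eq]
  aesop

end States

end CStarSep

theorem mainTheorem4 {A : Type*} {B : Type*} [CStarAlgebra A] [CStarAlgebra B] :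
    IsCompact (CStarSep.productStates A B) ∧
    ∀ ω ∈ CStarSep.separableStates A B,
      ∃ ν : Measure (CStarSep.productStates A B),
        IsProbabilityMeasure ν ∧ ν.Regular ∧ CStarSep.Represents ν ω :=
  ⟨CStarSep.isCompact_productStates, fun _ hω =>
    CStarSep.exists_regular_represents_of_mem_closedConvexHull CStarSep.isCompact_productStates hω⟩
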